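/- Let $n\ge 1$, let $\Omega\subset\mathbb R^n$ be a bounded open set, and let $(p_k)$ be a sequence in $(1,\infty)$ with $p_k\to\infty$. For each $k$ let $u_{k}\in W^{1,p_k}_0(\Omega)$ (the closure of $C_c^\infty(\Omega)$ in $W^{1,p_k}(\Omega)$) be a weak solution of $-\Delta_{p_k}u=1$ in $\Omega$, $u=0$ on $\partial\Omega$, that is, $\int_\Omega|\nabla u_k|^{p_k-2}\nabla u_k\cdot\nabla\eta\,dx=\int_\Omega\eta\,dx$ for all $\eta\in C_c^\infty(\Omega)$. Then there is a subsequence of $(u_k)$ whose members have representatives that are continuous on $\overline\Omega$ and vanish on $\partial\Omega$, and these representatives converge uniformly on $\overline\Omega$ to a function $u_\infty$ that is Hölder continuous on $\overline\Omega$ (with some exponent in $(0,1]$) and such that: 1. $u_\infty$ is a viscosity solution of $\min\{|\nabla u|-1,\,-\Delta_\infty u\}=0$ in $\Omega$, where $\Delta_\infty u=\sum_{i,j}u_{x_i}u_{x_ix_j}u_{x_j}$, and $u_\infty=0$ on $\partial\Omega$; 2. $u_\infty$ is a viscosity supersolution of $|\nabla u|-1=0$ in $\Omega$. Here, for a continuous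 $F$, an upper (resp. lower) semicontinuous function $u$ on $\Omega$ is a viscosity subsolution (resp. supersolution) of $F(\nabla u,D^2u)=0$ in $\Omega$ if, whenever $x\in\Omega$ and $v$ is of class $C^2$ near $x$ with $v(x)=u(x)$ and $v\ge u$ (resp. $v\le u$) near $x$, one has $F(\nabla v(x),D^2v(x))\le 0$ (resp. $\ge 0$); a viscosity solution is a function that is both. -/

import Mathlib

open MeasureTheory Filter Topology
open scoped ContDiff NNReal

namespace PTorsion

/-- The space `C_c^∞(Ω)` of smooth functions with compact support inside `Ω`. -/
def IsTestFunction {n : ℕ} (Ω : Set (EuclideanSpace ℝ (Fin n)))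
    (φ : EuclideanSpace ℝ (Fin n) → ℝ) : Prop :=
  ContDiff ℝ ∞ φ ∧ HasCompactSupport φ ∧ tsupport φ ⊆ Ω

/-- `G` is the weak (distributional) gradient of `u` in `Ω`. -/
def HasWeakGradient {n : ℕ} (Ω : Set (EuclideanSpace ℝ (Fin n)))
    (u : EuclideanSpace ℝ (Fin n) → ℝ)
    (G : EuclideanSpace ℝ (Fin n) → EuclideanSpace ℝ (Fin n)) : Prop :=
  LocallyIntegrableOn u Ω ∧ LocallyIntegrableOn G Ω ∧
    ∀ φ : EuclideanSpace ℝ (Fin n) → ℝ, IsTestFunction Ω φ →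
      ∫ x in Ω, u x • gradient φ x = - ∫ x in Ω, φ x • G x

/-- `u ∈ W^{1,p}(Ω)`, with weak gradient `G`. -/
def MemSobolev {n : ℕ} (p : ℝ) (Ω : Set (EuclideanSpace ℝ (Fin n)))
    (u : EuclideanSpace ℝ (Fin n) → ℝ)
    (G : EuclideanSpace ℝ (Fin n) → EuclideanSpace ℝ (Fin n)) : Prop :=
  MemLp u (ENNReal.ofReal p) (volume.restrict Ω) ∧
  MemLp G (ENNReal.ofReal p) (volume.restrict Ω) ∧
  HasWeakGradient Ω u G

/-- `u ∈ W^{1,p}_0(Ω)`, with weak gradient `G`: `u` lies in the closure of `C_c^∞(Ω)` with respect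
to the norm of `W^{1,p}(Ω)`. -/
def MemSobolevZero {n : ℕ} (p : ℝ) (Ω : Set (EuclideanSpace ℝ (Fin n)))
    (u : EuclideanSpace ℝ (Fin n) → ℝ)
    (G : EuclideanSpace ℝ (Fin n) → EuclideanSpace ℝ (Fin n)) : Prop :=
  MemSobolev p Ω u G ∧
  ∃ φ : ℕ → EuclideanSpace ℝ (Fin n) → ℝ,
    (∀ j, IsTestFunction Ω (φ j)) ∧
    Tendsto (fun j => eLpNorm (fun x => φ j x - u x) (ENNReal.ofReal p) (volume.restrict Ω))
      atTop (𝓝 0) ∧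
    Tendsto (fun j => eLpNorm (fun x => gradient (φ j) x - G x) (ENNReal.ofReal p)
      (volume.restrict Ω)) atTop (𝓝 0)

/-- `u` is a weak solution of `-Δ_p u = 1` in `Ω`, `u = 0` on `∂Ω`: it belongs to `W^{1,p}_0(Ω)`
and `∫_Ω |∇u|^{p-2} ∇u · ∇η dx = ∫_Ω η dx` for all `η ∈ C_c^∞(Ω)`. -/
def IsWeakSolution {n : ℕ} (p : ℝ) (Ω : Set (EuclideanSpace ℝ (Fin n)))
    (u : EuclideanSpace ℝ (Fin n) → ℝ) : Prop :=
  ∃ G : EuclideanSpace ℝ (Fin n) → EuclideanSpace ℝ (Fin n),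
    MemSobolevZero p Ω u G ∧
    ∀ η : EuclideanSpace ℝ (Fin n) → ℝ, IsTestFunction Ω η →
      ∫ x in Ω, ‖G x‖ ^ (p - 2) * inner ℝ (G x) (gradient η x) = ∫ x in Ω, η x

/-- The `C²` function `v` touches `u` from above in `x`. -/
def TouchesFromAbove {n : ℕ} (v u : EuclideanSpace ℝ (Fin n) → ℝ)
    (x : EuclideanSpace ℝ (Fin n)) : Prop :=
  ContDiffAt ℝ 2 v x ∧ v x = u x ∧ ∀ᶠ y in 𝓝 x, u y ≤ v y

/-- The `C²` function `w` touches `u` from below in `x`. -/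
def TouchesFromBelow {n : ℕ} (w u : EuclideanSpace ℝ (Fin n) → ℝ)
    (x : EuclideanSpace ℝ (Fin n)) : Prop :=
  ContDiffAt ℝ 2 w x ∧ w x = u x ∧ ∀ᶠ y in 𝓝 x, w y ≤ u y

/-- The Hessian `D²v(x)` as a bilinear form. -/
noncomputable def hessian {n : ℕ} (v : EuclideanSpace ℝ (Fin n) → ℝ)
    (x : EuclideanSpace ℝ (Fin n)) :
    EuclideanSpace ℝ (Fin n) →L[ℝ] EuclideanSpace ℝ (Fin n) →L[ℝ] ℝ :=
  fderiv ℝ (fderiv ℝ v) x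

/-- `u` is a viscosity subsolution of `F(∇u, D²u) = 0` in `Ω`. -/
def IsViscositySubsolution {n : ℕ}
    (F : EuclideanSpace ℝ (Fin n) →
      (EuclideanSpace ℝ (Fin n) →L[ℝ] EuclideanSpace ℝ (Fin n) →L[ℝ] ℝ) → ℝ)
    (Ω : Set (EuclideanSpace ℝ (Fin n))) (u : EuclideanSpace ℝ (Fin n) → ℝ) : Prop :=
  UpperSemicontinuousOn u Ω ∧
  ∀ x ∈ Ω, ∀ v : EuclideanSpace ℝ (Fin n) → ℝ, TouchesFromAbove v u x →
    F (gradient v x) (hessian v x) ≤ 0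

/-- `u` is a viscosity supersolution of `F(∇u, D²u) = 0` in `Ω`. -/
def IsViscositySupersolution {n : ℕ}
    (F : EuclideanSpace ℝ (Fin n) →
      (EuclideanSpace ℝ (Fin n) →L[ℝ] EuclideanSpace ℝ (Fin n) →L[ℝ] ℝ) → ℝ)
    (Ω : Set (EuclideanSpace ℝ (Fin n))) (u : EuclideanSpace ℝ (Fin n) → ℝ) : Prop :=
  LowerSemicontinuousOn u Ω ∧
  ∀ x ∈ Ω, ∀ w : EuclideanSpace ℝ (Fin n) → ℝ, TouchesFromBelow w u x →
    0 ≤ F (gradient w x) (hessian w x)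

/-- `u` is a viscosity solution of `F(∇u, D²u) = 0` in `Ω`. -/
def IsViscositySolution {n : ℕ}
    (F : EuclideanSpace ℝ (Fin n) →
      (EuclideanSpace ℝ (Fin n) →L[ℝ] EuclideanSpace ℝ (Fin n) →L[ℝ] ℝ) → ℝ)
    (Ω : Set (EuclideanSpace ℝ (Fin n))) (u : EuclideanSpace ℝ (Fin n) → ℝ) : Prop :=
  IsViscositySubsolution F Ω u ∧ IsViscositySupersolution F Ω u

/-- The operator `min{|∇u| - 1, -Δ_∞ u}` as a function of `ξ = ∇u` and `X = D²u`; here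
`Δ_∞ u = ∑ u_{x_i} u_{x_i x_j} u_{x_j} = D²u(∇u, ∇u)`. -/
noncomputable def limitOperator {n : ℕ} (ξ : EuclideanSpace ℝ (Fin n))
    (X : EuclideanSpace ℝ (Fin n) →L[ℝ] EuclideanSpace ℝ (Fin n) →L[ℝ] ℝ) : ℝ :=
  min (‖ξ‖ - 1) (-(X ξ ξ))

/-- The eikonal operator `|∇u| - 1` as a function of `ξ = ∇u` (and of `X = D²u`, which it does not
use). -/
noncomputable def eikonalOperator {n : ℕ} (ξ : EuclideanSpace ℝ (Fin n))
    (_X : EuclideanSpace ℝ (Fin n) →L[ℝ] EuclideanSpace ℝ (Fin n) →L[ℝ] ℝ) : ℝ :=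
  ‖ξ‖ - 1

end PTorsion

/-! The limit is explicit: `u_∞` is the distance to the complement of `Ω`, and the whole sequence
converges to it. No compactness argument is needed; the viscosity statements are checked directly on
the distance function.

Upper bound. `morrey_modulus` compares a function with its averages over balls of a free radius `r`;
for fixed `r` its constant tends to `1` as `p → ∞`. Testing the equation with the solution gives `∫
|∇u|^p = ∫ u`. Since `u` is bounded by a multiple of `M`, the `L^p` norm of its gradient, `M ^ p ≤ C
* M` and hence `M ≤ C ^ (1 / (p - 1)) → 1`. The solutions are thus asymptotically `1`-Lipschitz and
vanish outside `Ω`, so asymptotically they do not exceed the distance.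

Lower bound. Testing with a `1`-Lipschitz `η` and using Young's inequality gives `∫ η ≤ ∫ u + |Ω| /
p` (`integral_test_le_of_weak`). Such `η` approximate the distance, so asymptotically `∫ u` is at
least the integral of the distance. Together with the upper bound and the uniform modulus this
forces uniform convergence (`tendstoUniformly_infDist`).

Viscosity. The distance is `1`-Lipschitz and has slope exactly `-1` along a segment to a nearest
point of the complement; `touchesFromBelow_infDist` reads off both first and second order
information there. -/

namespace PTorsion

/-! ### Morrey's inequality with an asymptotically sharp constant -/

section Morrey

variable {E : Type*} [NormedAddCommGroup E] [NormedSpace ℝ E] [FiniteDimensional ℝ E]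
  [MeasurableSpace E] [BorelSpace E] (μ : Measure E) [μ.IsAddHaarMeasure]

open Module Metric

/-- Jensen's inequality for `t ^ p`, then enlarging the ball to the whole space and rescaling. The
prefactor is the measure of a ball of radius `r` to the power `-1 / p`. -/
lemma average_comp_ball_le {g : E → ℝ} (hg : Continuous g) (hgs : HasCompactSupport g)
    (hg0 : ∀ x, 0 ≤ g x) {p : ℝ} (hp : 1 ≤ p) (c : E) {r : ℝ} (hr : 0 < r) :
    ⨍ z in ball (0 : E) 1, g (c + r • z) ∂μ ≤
      (r ^ finrank ℝ E * μ.real (ball 0 1)) ^ (-(1 / p)) * (∫ x, g x ^ p ∂μ) ^ (1 / p) := by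
  have hp0 : 0 < p := by linarith
  have hV : 0 < μ.real (ball (0 : E) 1) :=
    ENNReal.toReal_pos (measure_ball_pos μ _ one_pos).ne' measure_ball_lt_top.ne
  have hr' : 0 < r ^ finrank ℝ E := pow_pos hr _
  have hcont : Continuous fun z : E => g (c + r • z) := by fun_prop
  have hcs : HasCompactSupport fun z : E => g (c + r • z) := by
    have h1 : HasCompactSupport fun z : E => g (c + z) := by
      simpa [Function.comp_def] using hgs.comp_homeomorph (Homeomorph.addLeft c)
    simpa [Function.comp_def] using h1.comp_smul hr.ne'
  have hcontp : Continuous fun z : E => g (c + r • z) ^ p :=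
    hcont.rpow_const fun _ => Or.inr hp0.le
  have hcsp : HasCompactSupport fun z : E => g (c + r • z) ^ p :=
    hcs.comp_left (g := fun t : ℝ => t ^ p) (by simp [hp0.ne'])
  have hip : Integrable (fun z : E => g (c + r • z) ^ p) μ := hcontp.integrable_of_hasCompactSupport hcsp
  have hi : Integrable (fun z : E => g (c + r • z)) μ := hcont.integrable_of_hasCompactSupport hcs
  have hJ := (convexOn_rpow hp).map_set_average_le (μ := μ) (t := ball (0 : E) 1)
    (f := fun z : E => g (c + r • z)) (Real.continuous_rpow_const hp0.le).continuousOn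
    isClosed_Ici (measure_ball_pos μ _ one_pos).ne' measure_ball_lt_top.ne
    (Eventually.of_forall fun z => hg0 _) hi.integrableOn hip.integrableOn
  have hI0 : 0 ≤ ∫ x, g x ^ p ∂μ := integral_nonneg fun x => Real.rpow_nonneg (hg0 x) _
  have h2 : ⨍ z in ball (0 : E) 1, g (c + r • z) ^ p ∂μ ≤
      (r ^ finrank ℝ E * μ.real (ball 0 1))⁻¹ * ∫ x, g x ^ p ∂μ := by
    rw [setAverage_eq, smul_eq_mul, mul_inv, mul_comm (r ^ _)⁻¹, mul_assoc]
    refine mul_le_mul_of_nonneg_left ?_ (inv_nonneg.2 hV.le)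
    calc ∫ z in ball (0 : E) 1, g (c + r • z) ^ p ∂μ ≤ ∫ z, g (c + r • z) ^ p ∂μ :=
          setIntegral_le_integral hip (Eventually.of_forall fun z => Real.rpow_nonneg (hg0 _) _)
      _ = (r ^ finrank ℝ E)⁻¹ * ∫ x, g x ^ p ∂μ := by
          rw [Measure.integral_comp_smul_of_nonneg μ (fun z => g (c + z) ^ p) r (hR := hr.le),
            smul_eq_mul, integral_add_left_eq_self (fun z => g z ^ p) c]
  have h0 : 0 ≤ ⨍ z in ball (0 : E) 1, g (c + r • z) ∂μ := by
    rw [setAverage_eq]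
    exact smul_nonneg (inv_nonneg.2 hV.le) (integral_nonneg fun _ => hg0 _)
  calc ⨍ z in ball (0 : E) 1, g (c + r • z) ∂μ
      = ((⨍ z in ball (0 : E) 1, g (c + r • z) ∂μ) ^ p) ^ (1 / p) := by
        rw [← Real.rpow_mul h0, mul_one_div_cancel hp0.ne', Real.rpow_one]
    _ ≤ ((r ^ finrank ℝ E * μ.real (ball 0 1))⁻¹ * ∫ x, g x ^ p ∂μ) ^ (1 / p) :=
        Real.rpow_le_rpow (Real.rpow_nonneg h0 _) (hJ.trans h2) (by positivity)
    _ = _ := by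
        rw [Real.mul_rpow (by positivity) hI0, Real.inv_rpow (by positivity),
          Real.rpow_neg (by positivity)]

/-- Centre and radius move together so that one computation serves both translation (`s = 0`) and
dilation (`e = 0`, `s = 1`). -/
lemma hasDerivAt_average_ball {φ : E → ℝ} (hφ : ContDiff ℝ 1 φ) (hφs : HasCompactSupport φ)
    (c e : E) (r s t : ℝ) :
    HasDerivAt (fun t : ℝ => ⨍ z in ball (0 : E) 1, φ (c + t • e + (r + t * s) • z) ∂μ)
      (⨍ z in ball (0 : E) 1, fderiv ℝ φ (c + t • e + (r + t * s) • z) (e + s • z) ∂μ) t := by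
  simp only [setAverage_eq, smul_eq_mul]
  have hd : Continuous (fderiv ℝ φ) := hφ.continuous_fderiv one_ne_zero
  obtain ⟨C, hC⟩ := hd.bounded_above_of_compact_support (hφs.fderiv (𝕜 := ℝ))
  have hC0 : 0 ≤ C := (norm_nonneg _).trans (hC 0)
  have : IsFiniteMeasure (μ.restrict (ball (0 : E) 1)) :=
    ⟨by simpa using (measure_ball_lt_top (μ := μ) (x := (0 : E)) (r := 1))⟩
  have hφc := hφ.continuous
  obtain ⟨C', hC'⟩ := hφc.bounded_above_of_compact_support hφs
  suffices h : HasDerivAt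
      (fun t : ℝ => ∫ z in ball (0 : E) 1, φ (c + t • e + (r + t * s) • z) ∂μ)
      (∫ z in ball (0 : E) 1, fderiv ℝ φ (c + t • e + (r + t * s) • z) (e + s • z) ∂μ) t from
    h.const_mul _
  refine (hasDerivAt_integral_of_dominated_loc_of_deriv_le
    (F := fun (t : ℝ) (z : E) => φ (c + t • e + (r + t * s) • z))
    (F' := fun (t : ℝ) (z : E) => fderiv ℝ φ (c + t • e + (r + t * s) • z) (e + s • z)) (s := Set.univ)
    (bound := fun _ => C * (‖e‖ + |s|)) univ_mem
    (Eventually.of_forall fun t => ?_) ?_ ?_ ?_ ?_ ?_).2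
  · exact (by fun_prop : Continuous fun z : E =>
      φ (c + t • e + (r + t * s) • z)).aestronglyMeasurable
  · exact Integrable.of_bound (by fun_prop : Continuous fun z : E =>
      φ (c + t • e + (r + t * s) • z)).aestronglyMeasurable C' (Eventually.of_forall fun _ => hC' _)
  · exact (by fun_prop : Continuous fun z : E =>
      fderiv ℝ φ (c + t • e + (r + t * s) • z) (e + s • z)).aestronglyMeasurable
  · filter_upwards [ae_restrict_mem measurableSet_ball] with z hz t _
    have hz' : ‖z‖ ≤ 1 := (mem_ball_zero_iff.1 hz).le
    refine (ContinuousLinearMap.le_opNorm _ _).trans ?_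
    gcongr
    · exact hC _
    · refine (norm_add_le _ _).trans ?_
      rw [norm_smul, Real.norm_eq_abs]
      gcongr
      exact mul_le_of_le_one_right (abs_nonneg _) hz'
  · exact integrable_const _
  · refine Eventually.of_forall fun z t _ => ?_
    have h1 : HasDerivAt (fun t : ℝ => c + t • e + (r + t * s) • z) (e + s • z) t := by
      exact ((((hasDerivAt_id t).smul_const e).const_add c).add
        ((((hasDerivAt_id t).mul_const s).const_add r).smul_const z)).congr_deriv (by simp)
    exact ((hφ.differentiable one_ne_zero).differentiableAt.hasFDerivAt).comp_hasDerivAt t h1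

lemma norm_average_fderiv_le {φ : E → ℝ} (hφ : ContDiff ℝ 1 φ) (hφs : HasCompactSupport φ)
    {p : ℝ} (hp : 1 ≤ p) (c e : E) {r : ℝ} (hr : 0 < r) (s : ℝ) :
    ‖⨍ z in ball (0 : E) 1, fderiv ℝ φ (c + r • z) (e + s • z) ∂μ‖ ≤
      (‖e‖ + |s|) * ((r ^ finrank ℝ E * μ.real (ball 0 1)) ^ (-(1 / p)) *
        (∫ x, ‖fderiv ℝ φ x‖ ^ p ∂μ) ^ (1 / p)) := by
  have hd : Continuous (fderiv ℝ φ) := hφ.continuous_fderiv one_ne_zero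
  have hds := hφs.fderiv (𝕜 := ℝ)
  refine le_trans ?_ (mul_le_mul_of_nonneg_left (average_comp_ball_le μ hd.norm hds.norm
    (fun _ => norm_nonneg _) hp c hr) (by positivity))
  simp only [setAverage_eq, smul_eq_mul]
  rw [norm_mul, Real.norm_of_nonneg (inv_nonneg.2 measureReal_nonneg), mul_left_comm]
  refine mul_le_mul_of_nonneg_left ?_ (by positivity)
  rw [← integral_const_mul]
  refine norm_integral_le_of_norm_le ?_ ?_
  · have : Continuous fun z : E => (‖e‖ + |s|) * ‖fderiv ℝ φ (c + r • z)‖ := by fun_prop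
    exact (this.continuousOn.integrableOn_compact (isCompact_closedBall 0 1)).mono_set
      ball_subset_closedBall
  · filter_upwards [ae_restrict_mem measurableSet_ball] with z hz
    have hz' : ‖z‖ ≤ 1 := (mem_ball_zero_iff.1 hz).le
    refine (ContinuousLinearMap.le_opNorm _ _).trans ?_
    rw [mul_comm]
    gcongr
    refine (norm_add_le _ _).trans ?_
    rw [norm_smul, Real.norm_eq_abs]
    gcongr
    exact mul_le_of_le_one_right (abs_nonneg _) hz'

lemma abs_average_ball_sub_average_ball_le {φ : E → ℝ} (hφ : ContDiff ℝ 1 φ)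
    (hφs : HasCompactSupport φ) {p : ℝ} (hp : 1 ≤ p) (x y : E) {r : ℝ} (hr : 0 < r) :
    |⨍ z in ball (0 : E) 1, φ (y + r • z) ∂μ - ⨍ z in ball (0 : E) 1, φ (x + r • z) ∂μ| ≤
      ‖y - x‖ * ((r ^ finrank ℝ E * μ.real (ball 0 1)) ^ (-(1 / p)) *
        (∫ x, ‖fderiv ℝ φ x‖ ^ p ∂μ) ^ (1 / p)) := by
  have hF := fun t : ℝ => hasDerivAt_average_ball μ hφ hφs x (y - x) r 0 t
  simp only [mul_zero, add_zero] at hF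
  have := (convex_univ : Convex ℝ (Set.univ : Set ℝ)).norm_image_sub_le_of_norm_hasDerivWithin_le
    (fun t _ => (hF t).hasDerivWithinAt) (fun t _ => by
      simpa using norm_average_fderiv_le μ hφ hφs hp (x + t • (y - x)) (y - x) hr 0)
    (Set.mem_univ 0) (Set.mem_univ 1)
  simpa using this

/-- The average over the ball of radius `t` has `t`-derivative at most `K * t ^ (-a)` with `a = n /
p ≤ 1 / 2`, which is integrable at `0`. The factor `2` bounds `1 / (1 - a)`. -/
lemma abs_average_ball_sub_le {φ : E → ℝ} (hφ : ContDiff ℝ 1 φ)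
    (hφs : HasCompactSupport φ) {p : ℝ} (hp : 1 ≤ p) (hpn : 2 * finrank ℝ E ≤ p) (x : E)
    {r : ℝ} (hr : 0 < r) :
    |⨍ z in ball (0 : E) 1, φ (x + r • z) ∂μ - φ x| ≤
      2 * r * ((r ^ finrank ℝ E * μ.real (ball 0 1)) ^ (-(1 / p)) *
        (∫ x, ‖fderiv ℝ φ x‖ ^ p ∂μ) ^ (1 / p)) := by
  have hp0 : 0 < p := by linarith
  have hV : 0 < μ.real (ball (0 : E) 1) :=
    ENNReal.toReal_pos (measure_ball_pos μ _ one_pos).ne' measure_ball_lt_top.ne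
  set N := (∫ x, ‖fderiv ℝ φ x‖ ^ p ∂μ) ^ (1 / p) with hN
  have hN0 : 0 ≤ N := by positivity
  set a : ℝ := finrank ℝ E / p with ha
  have ha1 : a ≤ 1 / 2 := by rw [ha, div_le_iff₀ hp0]; linarith
  have hκ : ∀ t : ℝ, 0 < t → (t ^ finrank ℝ E * μ.real (ball (0 : E) 1)) ^ (-(1 / p)) =
      t ^ (-a) * μ.real (ball (0 : E) 1) ^ (-(1 / p)) := by
    intro t ht
    rw [Real.mul_rpow (by positivity) hV.le, ← Real.rpow_natCast, ← Real.rpow_mul ht.le, ha]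
    congr 2
    ring
  set F : ℝ → ℝ := fun t => ⨍ z in ball (0 : E) 1, φ (x + t • z) ∂μ with hFdef
  have hF : ∀ t, HasDerivAt F (⨍ z in ball (0 : E) 1, fderiv ℝ φ (x + t • z) z ∂μ) t := by
    intro t
    simpa using hasDerivAt_average_ball μ hφ hφs x 0 0 1 t
  set K := μ.real (ball (0 : E) 1) ^ (-(1 / p)) * N with hK
  have hK0 : 0 ≤ K := by positivity
  have hF' : ∀ t : ℝ, 0 < t → |⨍ z in ball (0 : E) 1, fderiv ℝ φ (x + t • z) z ∂μ| ≤
      t ^ (-a) * K := by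
    intro t ht
    have := norm_average_fderiv_le μ hφ hφs hp x 0 ht 1
    rw [hκ t ht] at this
    simpa only [norm_zero, zero_add, abs_one, one_mul, one_smul, mul_assoc, hK,
      Real.norm_eq_abs] using this
  have hG : ∀ t : ℝ, 0 < t → HasDerivAt (fun t : ℝ => K / (1 - a) * t ^ (1 - a))
      (t ^ (-a) * K) t := by
    intro t ht
    have h := (Real.hasDerivAt_rpow_const (p := 1 - a) (Or.inl ht.ne')).const_mul (K / (1 - a))
    refine h.congr_deriv ?_
    have : 1 - a ≠ 0 := by linarith
    rw [show 1 - a - 1 = -a by ring]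
    field_simp
  have hGc : Continuous fun t : ℝ => K / (1 - a) * t ^ (1 - a) :=
    continuous_const.mul (Real.continuous_rpow_const (by linarith))
  have hFc : Continuous F := continuous_iff_continuousAt.2 fun t => (hF t).continuousAt
  have hF0 : F 0 = φ x := by
    simp only [hFdef, zero_smul, add_zero]
    exact setAverage_const (measure_ball_pos μ _ one_pos).ne' measure_ball_lt_top.ne _
  -- The primitive of the bound dominates `F` and `-F` in growth. Monotonicity needs derivatives
  -- only in the interior, so the singularity of `t ^ (-a)` at `0` is harmless.
  have hm : ∀ σ : ℝ, |σ| = 1 →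
      MonotoneOn (fun t : ℝ => K / (1 - a) * t ^ (1 - a) - σ * F t) (Set.Ici 0) := by
    intro σ hσ
    refine monotoneOn_of_deriv_nonneg (convex_Ici 0)
      (hGc.sub (continuous_const.mul hFc)).continuousOn ?_ ?_
    · intro t ht
      rw [interior_Ici] at ht
      exact ((hG t ht).sub ((hF t).const_mul σ)).differentiableAt.differentiableWithinAt
    · intro t ht
      rw [interior_Ici] at ht
      have hd : deriv (fun t : ℝ => K / (1 - a) * t ^ (1 - a) - σ * F t) t = _ :=
        ((hG t ht).sub ((hF t).const_mul σ)).deriv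
      rw [hd]
      have := hF' t ht
      have h2 := le_abs_self (σ * ⨍ z in ball (0 : E) 1, fderiv ℝ φ (x + t • z) z ∂μ)
      rw [abs_mul, hσ, one_mul] at h2
      linarith
  have hend : K / (1 - a) * r ^ (1 - a) ≤ 2 * r * ((r ^ finrank ℝ E *
      μ.real (ball (0 : E) 1)) ^ (-(1 / p)) * N) := by
    rw [hκ r hr, show 1 - a = 1 + -a by ring, Real.rpow_add hr, Real.rpow_one, div_mul_eq_mul_div,
      div_le_iff₀ (by linarith)]
    have : 0 ≤ K * (r * r ^ (-a)) := by positivity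
    rw [show 2 * r * (r ^ (-a) * μ.real (ball (0 : E) 1) ^ (-(1 / p)) * N) * (1 + -a) =
      (K * (r * r ^ (-a))) * (2 * (1 + -a)) by rw [hK]; ring]
    exact le_mul_of_one_le_right this (by linarith)
  have h1 := hm 1 (by simp) Set.self_mem_Ici (Set.mem_Ici.2 hr.le) hr.le
  have h2 := hm (-1) (by simp) Set.self_mem_Ici (Set.mem_Ici.2 hr.le) hr.le
  simp only [hF0, Real.zero_rpow (show 1 - a ≠ 0 by linarith), mul_zero] at h1 h2
  change |F r - φ x| ≤ _
  rw [abs_le]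
  constructor <;> linarith

/-- A form of Morrey's inequality whose constant tends to `1` as `p → ∞` and `r → 0`. -/
theorem morrey_modulus {φ : E → ℝ} (hφ : ContDiff ℝ 1 φ)
    (hφs : HasCompactSupport φ) {p : ℝ} (hp : 1 ≤ p) (hpn : 2 * finrank ℝ E ≤ p) (x y : E)
    {r : ℝ} (hr : 0 < r) :
    |φ x - φ y| ≤ (r ^ finrank ℝ E * μ.real (ball 0 1)) ^ (-(1 / p)) * (4 * r + ‖x - y‖) *
        (∫ x, ‖fderiv ℝ φ x‖ ^ p ∂μ) ^ (1 / p) := by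
  have h1 := abs_le.1 (abs_average_ball_sub_le μ hφ hφs hp hpn x hr)
  have h2 := abs_le.1 (abs_average_ball_sub_le μ hφ hφs hp hpn y hr)
  have h3 := abs_le.1 (abs_average_ball_sub_average_ball_le μ hφ hφs hp y x hr)
  rw [abs_le]
  constructor <;> linarith [h1.1, h1.2, h2.1, h2.2, h3.1, h3.2]

end Morrey

/-! ### Continuous representatives of functions in `W^{1,p}_0` -/

section Sobolev

variable {n : ℕ} {Ω : Set (EuclideanSpace ℝ (Fin n))}

/-- The factor in `morrey_modulus`. -/
noncomputable def morreyFactor (n : ℕ) (p r : ℝ) : ℝ :=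
  (r ^ n * volume.real (Metric.ball (0 : EuclideanSpace ℝ (Fin n)) 1)) ^ (-(1 / p))

lemma morreyFactor_nonneg (n : ℕ) (p : ℝ) {r : ℝ} (hr : 0 < r) : 0 ≤ morreyFactor n p r := by
  unfold morreyFactor; positivity

lemma norm_gradient (φ : EuclideanSpace ℝ (Fin n) → ℝ) (x : EuclideanSpace ℝ (Fin n)) :
    ‖gradient φ x‖ = ‖fderiv ℝ φ x‖ := by
  rw [gradient, LinearIsometryEquiv.norm_map]

lemma IsTestFunction.continuous {φ : EuclideanSpace ℝ (Fin n) → ℝ} (h : IsTestFunction Ω φ) :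
    Continuous φ := h.1.continuous

lemma IsTestFunction.eq_zero {φ : EuclideanSpace ℝ (Fin n) → ℝ} (h : IsTestFunction Ω φ)
    {x : EuclideanSpace ℝ (Fin n)} (hx : x ∉ Ω) : φ x = 0 :=
  image_eq_zero_of_notMem_tsupport fun hx' => hx (h.2.2 hx')

lemma IsTestFunction.fderiv_eq_zero {φ : EuclideanSpace ℝ (Fin n) → ℝ} (h : IsTestFunction Ω φ)
    {x : EuclideanSpace ℝ (Fin n)} (hx : x ∉ Ω) : fderiv ℝ φ x = 0 :=
  image_eq_zero_of_notMem_tsupport fun hx' => hx (h.2.2 (tsupport_fderiv_subset ℝ hx'))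

lemma IsTestFunction.continuous_gradient {φ : EuclideanSpace ℝ (Fin n) → ℝ}
    (h : IsTestFunction Ω φ) : Continuous (gradient φ) :=
  (LinearIsometryEquiv.continuous _).comp (h.1.continuous_fderiv (by simp))

lemma IsTestFunction.sub {φ ψ : EuclideanSpace ℝ (Fin n) → ℝ} (hφ : IsTestFunction Ω φ)
    (hψ : IsTestFunction Ω ψ) : IsTestFunction Ω (φ - ψ) :=
  ⟨hφ.1.sub hψ.1, hφ.2.1.sub hψ.2.1,
    (tsupport_sub φ ψ).trans (Set.union_subset hφ.2.2 hψ.2.2)⟩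

lemma IsTestFunction.gradient_sub {φ ψ : EuclideanSpace ℝ (Fin n) → ℝ} (hφ : IsTestFunction Ω φ)
    (hψ : IsTestFunction Ω ψ) : gradient (φ - ψ) = gradient φ - gradient ψ := by
  ext1 x
  simp only [gradient, Pi.sub_apply]
  rw [fderiv_sub (hφ.1.differentiable (by simp) x) (hψ.1.differentiable (by simp) x), map_sub]

lemma IsTestFunction.memLp {φ : EuclideanSpace ℝ (Fin n) → ℝ} (h : IsTestFunction Ω φ)
    (q : ENNReal) (μ : Measure (EuclideanSpace ℝ (Fin n))) [IsFiniteMeasureOnCompacts μ] :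
    MemLp φ q μ :=
  h.continuous.memLp_of_hasCompactSupport h.2.1

lemma IsTestFunction.memLp_gradient {φ : EuclideanSpace ℝ (Fin n) → ℝ} (h : IsTestFunction Ω φ)
    (q : ENNReal) (μ : Measure (EuclideanSpace ℝ (Fin n))) [IsFiniteMeasureOnCompacts μ] :
    MemLp (gradient φ) q μ :=
  h.continuous_gradient.memLp_of_hasCompactSupport
    ((h.2.1.fderiv (𝕜 := ℝ)).comp_left (map_zero _))

lemma toReal_eLpNorm_eq {F : Type*} [NormedAddCommGroup F] {α : Type*} {m : MeasurableSpace α}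
    {μ : Measure α} {f : α → F} {p : ℝ} (hp : 0 < p) (hf : MemLp f (ENNReal.ofReal p) μ) :
    (eLpNorm f (ENNReal.ofReal p) μ).toReal = (∫ x, ‖f x‖ ^ p ∂μ) ^ (1 / p) := by
  rw [hf.eLpNorm_eq_integral_rpow_norm (by simpa using hp) ENNReal.ofReal_ne_top,
    ENNReal.toReal_ofReal hp.le, one_div, ENNReal.toReal_ofReal]
  exact Real.rpow_nonneg (integral_nonneg fun _ => Real.rpow_nonneg (norm_nonneg _) _) _

lemma IsTestFunction.abs_sub_le {φ : EuclideanSpace ℝ (Fin n) → ℝ} (h : IsTestFunction Ω φ)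
    {p : ℝ} (hp : 1 ≤ p) (hpn : 2 * n ≤ p) {r : ℝ} (hr : 0 < r) (x y : EuclideanSpace ℝ (Fin n)) :
    |φ x - φ y| ≤ morreyFactor n p r * (4 * r + ‖x - y‖) *
      (eLpNorm (gradient φ) (ENNReal.ofReal p) (volume.restrict Ω)).toReal := by
  have := morrey_modulus volume (h.1.of_le (by simp)) h.2.1 hp (by simpa using hpn) x y hr
  rw [toReal_eLpNorm_eq (by linarith) (h.memLp_gradient _ _)]
  simp only [norm_gradient]
  rw [setIntegral_eq_integral_of_forall_compl_eq_zero fun x hx => by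
    rw [h.fderiv_eq_zero hx, norm_zero, Real.zero_rpow (by linarith)]]
  simpa [morreyFactor] using this

/-- This is where `n ≥ 1` matters: the space is unbounded, so a bounded set has a point outside it.
-/
lemma exists_notMem_norm_sub_le (hn : 1 ≤ n) (hΩb : Bornology.IsBounded Ω) :
    ∃ D : ℝ, 0 ≤ D ∧ ∀ x ∈ Ω, ∃ y ∉ Ω, ‖x - y‖ ≤ D := by
  have : Nonempty (Fin n) := ⟨⟨0, hn⟩⟩
  obtain ⟨y, hy⟩ : ∃ y, y ∉ Ω := by
    by_contra! h
    exact NormedSpace.unbounded_univ ℝ (EuclideanSpace ℝ (Fin n)) (hΩb.subset fun x _ => h x)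
  obtain ⟨R, hR⟩ := hΩb.subset_closedBall y
  exact ⟨max R 0, le_max_right _ _, fun x hx => ⟨y, hy, (mem_closedBall_iff_norm.1 (hR hx)).trans
    (le_max_left _ _)⟩⟩

lemma abs_le_of_modulus {v : EuclideanSpace ℝ (Fin n) → ℝ} (h0 : ∀ x ∉ Ω, v x = 0) {a b D : ℝ}
    (ha : 0 ≤ a) (hb : 0 ≤ b) (hD0 : 0 ≤ D) (hD : ∀ x ∈ Ω, ∃ y ∉ Ω, ‖x - y‖ ≤ D)
    (hv : ∀ x y, |v x - v y| ≤ a * (4 * 1 + ‖x - y‖) * b) (x : EuclideanSpace ℝ (Fin n)) :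
    |v x| ≤ a * (4 + D) * b := by
  by_cases hx : x ∈ Ω
  · obtain ⟨y, hy, hxy⟩ := hD x hx
    have := hv x y
    rw [h0 y hy, sub_zero, mul_one] at this
    exact this.trans (by gcongr)
  · rw [h0 x hx, abs_zero]
    positivity

/-- Functions in `W^{1,p}_0(Ω)`, `p ≥ 2n`, have a continuous representative that vanishes outside
`Ω` and obeys the modulus of continuity of `morrey_modulus`. -/
theorem MemSobolevZero.exists_continuous_representative (hn : 1 ≤ n)
    (hΩb : Bornology.IsBounded Ω) {p : ℝ} (hp : 1 ≤ p) (hpn : 2 * n ≤ p)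
    {u : EuclideanSpace ℝ (Fin n) → ℝ} {G : EuclideanSpace ℝ (Fin n) → EuclideanSpace ℝ (Fin n)}
    (h : MemSobolevZero p Ω u G) :
    ∃ v : EuclideanSpace ℝ (Fin n) → ℝ, Continuous v ∧ (∀ x ∉ Ω, v x = 0) ∧
      v =ᵐ[volume.restrict Ω] u ∧ ∀ r : ℝ, 0 < r → ∀ x y, |v x - v y| ≤
        morreyFactor n p r * (4 * r + ‖x - y‖) *
          (eLpNorm G (ENNReal.ofReal p) (volume.restrict Ω)).toReal := by
  obtain ⟨⟨hu, hG, -⟩, φ, hφ, hφu, hφG⟩ := h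
  have hp1 : (1 : ENNReal) ≤ ENNReal.ofReal p := by simpa using hp
  set q := ENNReal.ofReal p with hq
  set ν := volume.restrict Ω with hν
  obtain ⟨D, hD0, hD⟩ := exists_notMem_norm_sub_le hn hΩb
  set a : ℕ → ℝ := fun j => (eLpNorm (fun x => gradient (φ j) x - G x) q ν).toReal with ha
  have ha0 : Tendsto a atTop (𝓝 0) := by
    simpa [ha, Function.comp_def] using (ENNReal.tendsto_toReal ENNReal.zero_ne_top).comp hφG
  have hgm : ∀ j, MemLp (gradient (φ j)) q ν := fun j => (hφ j).memLp_gradient _ _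
  have hdm : ∀ j, MemLp (gradient (φ j) - G) q ν := fun j => (hgm j).sub hG
  have hN : ∀ j, (eLpNorm (gradient (φ j)) q ν).toReal ≤ (eLpNorm G q ν).toReal + a j := by
    intro j
    have := eLpNorm_add_le hG.1 (hdm j).1 hp1
    rw [add_sub_cancel] at this
    rw [ha]
    exact (ENNReal.toReal_mono (ENNReal.add_ne_top.2 ⟨hG.2.ne, (hdm j).2.ne⟩) this).trans
      ENNReal.toReal_add_le
  have hN2 : ∀ i j, (eLpNorm (gradient (φ i - φ j)) q ν).toReal ≤ a i + a j := by
    intro i j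
    rw [(hφ i).gradient_sub (hφ j), show gradient (φ i) - gradient (φ j) =
      (gradient (φ i) - G) - (gradient (φ j) - G) by abel]
    exact (ENNReal.toReal_mono (ENNReal.add_ne_top.2 ⟨(hdm i).2.ne, (hdm j).2.ne⟩)
      (eLpNorm_sub_le (hdm i).1 (hdm j).1 hp1)).trans ENNReal.toReal_add_le
  set K := morreyFactor n p 1 * (4 + D) with hK
  have hm0 := morreyFactor_nonneg n p one_pos
  have hK0 : 0 ≤ K := by positivity
  -- Morrey applied to differences turns `L^p` convergence of the gradients into a uniform Cauchy
  -- estimate.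
  have hsup : ∀ i j x, |φ i x - φ j x| ≤ K * (a i + a j) := by
    intro i j x
    have h1 := abs_le_of_modulus (v := φ i - φ j) (fun x hx => ((hφ i).sub (hφ j)).eq_zero hx)
      hm0 ENNReal.toReal_nonneg hD0 hD (((hφ i).sub (hφ j)).abs_sub_le hp hpn one_pos) x
    exact h1.trans (mul_le_mul_of_nonneg_left (hN2 i j) hK0)
  have hcau : UniformCauchySeqOn φ atTop Set.univ := by
    rw [Metric.uniformCauchySeqOn_iff]
    intro ε hε
    have : Tendsto (fun j => K * (a j)) atTop (𝓝 (K * 0)) := ha0.const_mul K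
    rw [mul_zero] at this
    obtain ⟨N, hN⟩ := eventually_atTop.1 (this.eventually_lt_const (half_pos hε))
    refine ⟨N, fun i hi j hj x _ => ?_⟩
    rw [Real.dist_eq]
    have := hsup i j x
    linarith [hN i hi, hN j hj]
  have hlim : ∀ x, ∃ l, Tendsto (fun j => φ j x) atTop (𝓝 l) := fun x =>
    cauchySeq_tendsto_of_complete (hcau.cauchySeq (Set.mem_univ x))
  choose v hv using hlim
  have hunif : TendstoUniformlyOn φ v atTop Set.univ :=
    hcau.tendstoUniformlyOn_of_tendsto fun x _ => hv x
  refine ⟨v, ?_, ?_, ?_, ?_⟩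
  · exact (tendstoUniformlyOn_univ.1 hunif).continuous
      (Frequently.of_forall fun j => (hφ j).continuous)
  · intro x hx
    refine tendsto_nhds_unique (hv x) ?_
    simp only [(hφ _).eq_zero hx]
    exact tendsto_const_nhds
  · have hme := tendstoInMeasure_of_tendsto_eLpNorm (zero_lt_one.trans_le hp1).ne'
      (fun j => ((hφ j).memLp q ν).1) hu.1 hφu
    obtain ⟨ns, hns, hae⟩ := hme.exists_seq_tendsto_ae
    filter_upwards [hae] with x hx
    exact tendsto_nhds_unique ((hv x).comp hns.tendsto_atTop) hx
  · intro r hr x y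
    have h1 : Tendsto (fun j => |φ j x - φ j y|) atTop (𝓝 |v x - v y|) :=
      ((hv x).sub (hv y)).abs
    have h2 : Tendsto (fun j => morreyFactor n p r * (4 * r + ‖x - y‖) *
        ((eLpNorm G q ν).toReal + a j)) atTop (𝓝 (morreyFactor n p r * (4 * r + ‖x - y‖) *
        ((eLpNorm G q ν).toReal + 0))) := (ha0.const_add _).const_mul _
    rw [add_zero] at h2
    refine le_of_tendsto_of_tendsto' h1 h2 fun j => ?_
    exact ((hφ j).abs_sub_le hp hpn hr x y).trans (mul_le_mul_of_nonneg_left (hN j)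
      (mul_nonneg (morreyFactor_nonneg n p hr) (by positivity)))

end Sobolev

/-! ### Energy identity and comparison of integrals -/

section Energy

/-- By Hölder's inequality the pairing is continuous in its second argument; this extends the weak
formulation from test functions to their closure. -/
lemma tendsto_integral_inner {α F : Type*} {m : MeasurableSpace α} {μ : Measure α}
    [NormedAddCommGroup F] [InnerProductSpace ℝ F] {p q : ENNReal} [p.HolderTriple q 1]
    {H f : α → F} {g : ℕ → α → F} (hH : MemLp H p μ) (hf : MemLp f q μ) (hg : ∀ j, MemLp (g j) q μ)
    (h : Tendsto (fun j => eLpNorm (fun x => g j x - f x) q μ) atTop (𝓝 0)) :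
    Tendsto (fun j => ∫ x, inner ℝ (H x) (g j x) ∂μ) atTop (𝓝 (∫ x, inner ℝ (H x) (f x) ∂μ)) := by
  have hle : ∀ k : α → F, MemLp k q μ →
      eLpNorm (fun x => inner ℝ (H x) (k x)) 1 μ ≤ eLpNorm H p μ * eLpNorm k q μ := by
    intro k hk
    simpa using eLpNorm_le_eLpNorm_mul_eLpNorm'_of_norm (r := 1) hH.1 hk.1
      (fun a b => (inner ℝ a b : ℝ)) 1
      (Eventually.of_forall fun x => by simpa using norm_inner_le_norm (𝕜 := ℝ) (H x) (k x))
  have hint : ∀ k : α → F, MemLp k q μ → Integrable (fun x => (inner ℝ (H x) (k x) : ℝ)) μ :=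
    fun k hk => memLp_one_iff_integrable.1 ⟨hH.1.inner hk.1, (hle k hk).trans_lt
      (ENNReal.mul_lt_top hH.2 hk.2)⟩
  refine tendsto_integral_of_L1' _ (hint f hf).1 (Eventually.of_forall fun j => hint _ (hg j)) ?_
  have h0 : Tendsto (fun j => eLpNorm H p μ * eLpNorm (fun x => g j x - f x) q μ) atTop (𝓝 0) := by
    simpa using ENNReal.Tendsto.const_mul h (Or.inr hH.2.ne)
  refine tendsto_of_tendsto_of_tendsto_of_le_of_le tendsto_const_nhds h0 (fun _ => zero_le) ?_
  intro j
  refine le_trans (le_of_eq ?_) (hle _ ((hg j).sub hf))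
  refine congrArg (fun k => eLpNorm k 1 μ) ?_
  ext x
  simp [inner_sub_right]

variable {n : ℕ} {Ω : Set (EuclideanSpace ℝ (Fin n))}

lemma norm_rpow_smul {F : Type*} [NormedAddCommGroup F] [NormedSpace ℝ F] {p : ℝ}
    (hp : 1 < p) (ξ : F) : ‖‖ξ‖ ^ (p - 2) • ξ‖ = ‖ξ‖ ^ (p - 1) := by
  rw [norm_smul, Real.norm_of_nonneg (Real.rpow_nonneg (norm_nonneg _) _)]
  rcases (norm_nonneg ξ).eq_or_lt with h | h
  · rw [← h, mul_zero, Real.zero_rpow (by linarith)]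
  · rw [← Real.rpow_add_one h.ne']
    congr 1
    ring

lemma memLp_rpow_smul {F : Type*} [NormedAddCommGroup F] [InnerProductSpace ℝ F] {α : Type*}
    {m : MeasurableSpace α} {μ : Measure α} {G : α → F} {p : ℝ} (hp : 1 < p)
    (hG : MemLp G (ENNReal.ofReal p) μ) :
    MemLp (fun x => ‖G x‖ ^ (p - 2) • G x) (ENNReal.ofReal p.conjExponent) μ := by
  have h1 := hG.norm_rpow_div (ENNReal.ofReal (p - 1))
  rw [ENNReal.toReal_ofReal (by linarith), ← ENNReal.ofReal_div_of_pos (by linarith)] at h1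
  refine h1.congr_norm ?_ (Eventually.of_forall fun x => ?_)
  · exact ((hG.1.norm.aemeasurable.pow_const (p - 2)).aestronglyMeasurable).smul hG.1
  · rw [norm_rpow_smul hp, Real.norm_of_nonneg (Real.rpow_nonneg (norm_nonneg _) _)]

lemma rpow_mul_inner_self {F : Type*} [NormedAddCommGroup F] [InnerProductSpace ℝ F] {p : ℝ}
    (hp : 1 < p) (ξ : F) : inner ℝ (‖ξ‖ ^ (p - 2) • ξ) ξ = ‖ξ‖ ^ p := by
  rw [real_inner_smul_left, real_inner_self_eq_norm_sq]
  rcases (norm_nonneg ξ).eq_or_lt with h | h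
  · rw [← h, Real.zero_rpow (by linarith : p ≠ 0)]; simp
  · rw [← Real.rpow_natCast, ← Real.rpow_add h]
    congr 1
    push_cast
    ring

/-- The energy identity: a weak solution may be used as a test function. -/
theorem integral_rpow_eq_of_weak (hΩb : Bornology.IsBounded Ω) {p : ℝ} (hp : 1 < p)
    {u : EuclideanSpace ℝ (Fin n) → ℝ} {G : EuclideanSpace ℝ (Fin n) → EuclideanSpace ℝ (Fin n)}
    (h : MemSobolevZero p Ω u G)
    (hw : ∀ η : EuclideanSpace ℝ (Fin n) → ℝ, IsTestFunction Ω η →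
      ∫ x in Ω, ‖G x‖ ^ (p - 2) * inner ℝ (G x) (gradient η x) = ∫ x in Ω, η x) :
    ∫ x in Ω, ‖G x‖ ^ p = ∫ x in Ω, u x := by
  obtain ⟨⟨hu, hG, -⟩, φ, hφ, hφu, hφG⟩ := h
  have : IsFiniteMeasure (volume.restrict Ω) := ⟨by simpa using hΩb.measure_lt_top⟩
  have hc := (Real.HolderConjugate.conjExponent hp).symm.ennrealOfReal
  have : (ENNReal.ofReal p.conjExponent).HolderTriple (ENNReal.ofReal p) 1 := hc
  have h1 := tendsto_integral_inner (memLp_rpow_smul hp hG) hG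
    (fun j => (hφ j).memLp_gradient _ _) hφG
  have h2 := tendsto_integral_inner (memLp_const (μ := volume.restrict Ω)
    (p := ENNReal.ofReal p.conjExponent) (1 : ℝ)) hu (fun j => (hφ j).memLp _ _) hφu
  simp only [rpow_mul_inner_self hp] at h1
  simp only [real_inner_smul_left, hw _ (hφ _)] at h1
  refine tendsto_nhds_unique h1 ?_
  simpa using h2

/-- Pointwise, Young's inequality gives `|G|^(p-1) * 1 ≤ 1 / p + |G|^p`; after integration the
energy identity replaces `∫ |G|^p` by `∫ u`. -/
theorem integral_test_le_of_weak (hΩb : Bornology.IsBounded Ω) {p : ℝ} (hp : 1 < p)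
    {u : EuclideanSpace ℝ (Fin n) → ℝ} {G : EuclideanSpace ℝ (Fin n) → EuclideanSpace ℝ (Fin n)}
    (h : MemSobolevZero p Ω u G)
    (hw : ∀ η : EuclideanSpace ℝ (Fin n) → ℝ, IsTestFunction Ω η →
      ∫ x in Ω, ‖G x‖ ^ (p - 2) * inner ℝ (G x) (gradient η x) = ∫ x in Ω, η x)
    {η : EuclideanSpace ℝ (Fin n) → ℝ} (hη : IsTestFunction Ω η)
    (hη1 : ∀ x, ‖gradient η x‖ ≤ 1) :
    ∫ x in Ω, η x ≤ (∫ x in Ω, u x) + volume.real Ω / p := by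
  have hp0 : 0 < p := by linarith
  have hG := h.1.2.1
  have : IsFiniteMeasure (volume.restrict Ω) := ⟨by simpa using hΩb.measure_lt_top⟩
  have hq := Real.HolderConjugate.conjExponent hp
  have hI : Integrable (fun x => ‖G x‖ ^ p) (volume.restrict Ω) := by
    simpa [ENNReal.toReal_ofReal hp0.le] using
      hG.integrable_norm_rpow (by simpa using hp0) ENNReal.ofReal_ne_top
  rw [← integral_rpow_eq_of_weak hΩb hp h hw, ← hw η hη]
  have hsum : ∫ x in Ω, (‖G x‖ ^ p + 1 / p) = (∫ x in Ω, ‖G x‖ ^ p) + volume.real Ω / p := by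
    rw [integral_add hI (integrable_const _)]
    simp [div_eq_mul_inv]
  rw [← hsum]
  refine (Real.le_norm_self _).trans
    (norm_integral_le_of_norm_le (hI.add (integrable_const _)) (Eventually.of_forall fun x => ?_))
  rw [← real_inner_smul_left]
  have hy := Real.young_inequality_of_nonneg zero_le_one
    (Real.rpow_nonneg (norm_nonneg (G x)) (p - 1)) hq
  rw [one_mul, Real.one_rpow, ← Real.rpow_mul (norm_nonneg _), Real.conjExponent,
    mul_div_cancel₀ p (by linarith : p - 1 ≠ 0)] at hy
  have hq1 : 1 ≤ p / (p - 1) := hq.symm.lt.le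
  calc ‖inner ℝ (‖G x‖ ^ (p - 2) • G x) (gradient η x)‖
      ≤ ‖‖G x‖ ^ (p - 2) • G x‖ * ‖gradient η x‖ := norm_inner_le_norm _ _
    _ ≤ ‖G x‖ ^ (p - 1) * 1 := by
        rw [norm_rpow_smul hp]
        exact mul_le_mul_of_nonneg_left (hη1 x) (Real.rpow_nonneg (norm_nonneg _) _)
    _ ≤ 1 / p + ‖G x‖ ^ p / (p / (p - 1)) := by rwa [mul_one]
    _ ≤ ‖G x‖ ^ p + 1 / p := by
        have := div_le_self (Real.rpow_nonneg (norm_nonneg (G x)) p) hq1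
        linarith

end Energy

/-! ### The distance function as a viscosity solution -/

section Viscosity

variable {n : ℕ} {Ω : Set (EuclideanSpace ℝ (Fin n))}

lemma hasDerivAt_line {v : EuclideanSpace ℝ (Fin n) → ℝ} {x e : EuclideanSpace ℝ (Fin n)} {t : ℝ}
    (hv : DifferentiableAt ℝ v (x + t • e)) :
    HasDerivAt (fun t : ℝ => v (x + t • e)) (fderiv ℝ v (x + t • e) e) t :=
  hv.hasFDerivAt.comp_hasDerivAt t
    ((((hasDerivAt_id t).smul_const e).const_add x).congr_deriv (by simp))

lemma tendsto_line (x e : EuclideanSpace ℝ (Fin n)) :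
    Tendsto (fun t : ℝ => x + t • e) (𝓝 0) (𝓝 x) := by
  have : Continuous fun t : ℝ => x + t • e := by fun_prop
  simpa using this.tendsto 0

lemma le_fderiv_of_eventually {v : EuclideanSpace ℝ (Fin n) → ℝ} {x e : EuclideanSpace ℝ (Fin n)}
    (hv : DifferentiableAt ℝ v x) {c : ℝ} (h : ∀ᶠ t : ℝ in 𝓝[>] 0, v x + t * c ≤ v (x + t • e)) :
    c ≤ fderiv ℝ v x e := by
  have h1 : HasDerivAt (fun t : ℝ => v (x + t • e)) (fderiv ℝ v x e) 0 := by
    simpa using hasDerivAt_line (x := x) (e := e) (t := 0) (by simpa using hv)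
  refine ge_of_tendsto h1.tendsto_slope_zero_right ?_
  filter_upwards [h, self_mem_nhdsWithin] with t ht ht0
  have ht0' : (0 : ℝ) < t := ht0
  simp only [zero_add, zero_smul, add_zero, smul_eq_mul]
  rw [inv_mul_eq_div, le_div_iff₀ ht0']
  linarith

lemma norm_fderiv_le_one_of_eventually {v : EuclideanSpace ℝ (Fin n) → ℝ}
    {x : EuclideanSpace ℝ (Fin n)} (hv : DifferentiableAt ℝ v x)
    (h : ∀ᶠ y in 𝓝 x, v x - ‖y - x‖ ≤ v y) : ‖fderiv ℝ v x‖ ≤ 1 := by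
  have key : ∀ e, -‖e‖ ≤ fderiv ℝ v x e := by
    intro e
    refine le_fderiv_of_eventually hv ?_
    filter_upwards [((tendsto_line x e).eventually h).filter_mono nhdsWithin_le_nhds,
      self_mem_nhdsWithin] with t ht ht0
    have ht0' : (0 : ℝ) < t := ht0
    rw [add_sub_cancel_left, norm_smul, Real.norm_of_nonneg ht0'.le] at ht
    linarith
  refine ContinuousLinearMap.opNorm_le_bound _ zero_le_one fun e => ?_
  rw [Real.norm_eq_abs, abs_le, one_mul]
  refine ⟨key e, ?_⟩
  have := key (-e)
  rw [norm_neg, map_neg] at this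
  linarith

lemma infDist_le_add (x y : EuclideanSpace ℝ (Fin n)) :
    Metric.infDist x Ωᶜ ≤ Metric.infDist y Ωᶜ + ‖x - y‖ := by
  simpa [dist_eq_norm] using Metric.infDist_le_infDist_add_dist (s := Ωᶜ) (x := x) (y := y)

/-- The bound `d y ≥ d x - ‖y - x‖` passes to any `v ≥ d` that agrees with `d` at `x`. -/
lemma norm_gradient_le_one_of_touchesFromAbove {v : EuclideanSpace ℝ (Fin n) → ℝ}
    {x : EuclideanSpace ℝ (Fin n)} (h : TouchesFromAbove v (Metric.infDist · Ωᶜ) x) :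
    ‖gradient v x‖ ≤ 1 := by
  obtain ⟨hc, he, hle⟩ := h
  rw [norm_gradient]
  refine norm_fderiv_le_one_of_eventually (hc.differentiableAt (by simp)) ?_
  filter_upwards [hle] with y hy
  have := infDist_le_add (Ω := Ω) x y
  rw [norm_sub_rev] at this
  linarith

/-- A positive second derivative would make `a` a local minimum as well, so `h` would be locally
constant. -/
lemma deriv_deriv_nonpos_of_isLocalMax {h : ℝ → ℝ} {a : ℝ} (hc : ContinuousAt h a)
    (hm : IsLocalMax h a) : deriv (deriv h) a ≤ 0 := by
  by_contra! hpos
  have hmin := isLocalMin_of_deriv_deriv_pos hpos hm.deriv_eq_zero hc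
  have heq : h =ᶠ[𝓝 a] fun _ => h a := by
    filter_upwards [hm, hmin] with t h1 h2 using le_antisymm h1 h2
  have := heq.deriv.deriv_eq
  simp only [deriv_const'] at this
  exact hpos.ne' this

/-- Let `e` be the unit vector towards a nearest point of the complement. Then `w (x + t • e) + t`
has a local maximum at `t = 0`. At first order, slope at most `-1` and norm at most `1` force the
gradient to be `-e`; at second order, the Hessian is nonpositive on `(e, e)`. -/
lemma touchesFromBelow_infDist (hΩo : IsOpen Ω) (hne : Ωᶜ.Nonempty)
    {w : EuclideanSpace ℝ (Fin n) → ℝ} {x : EuclideanSpace ℝ (Fin n)} (hx : x ∈ Ω)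
    (h : TouchesFromBelow w (Metric.infDist · Ωᶜ) x) :
    ‖gradient w x‖ = 1 ∧ hessian w x (gradient w x) (gradient w x) ≤ 0 := by
  obtain ⟨hc, he, hle⟩ := h
  have hd := hc.differentiableAt (by simp)
  have hnorm : ‖fderiv ℝ w x‖ ≤ 1 := by
    have := norm_fderiv_le_one_of_eventually (v := fun y => -w y) (x := x) hd.neg (by
      filter_upwards [hle] with y hy
      have := infDist_le_add (Ω := Ω) y x
      linarith)
    simpa [fderiv_fun_neg] using this
  obtain ⟨y, hy, hxy⟩ := hΩo.isClosed_compl.exists_infDist_eq_dist hne x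
  have hpos : 0 < Metric.infDist x Ωᶜ :=
    (hΩo.isClosed_compl.notMem_iff_infDist_pos hne).1 (fun h => h hx)
  set d := Metric.infDist x Ωᶜ with hdd
  set e : EuclideanSpace ℝ (Fin n) := d⁻¹ • (y - x) with hedef
  have hnyx : ‖y - x‖ = d := by rw [hxy, dist_eq_norm, norm_sub_rev]
  have he1 : ‖e‖ = 1 := by
    rw [hedef, norm_smul, hnyx, norm_inv, Real.norm_of_nonneg hpos.le, inv_mul_cancel₀ hpos.ne']
  have hye : y = x + d • e := by
    rw [hedef, smul_smul, mul_inv_cancel₀ hpos.ne', one_smul, add_sub_cancel]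
  -- Valid for both signs of `t`: the nearest point `y` lies on the line, at distance `d - t` from
  -- `x + t • e` whenever `t < d`.
  have hray : ∀ᶠ t : ℝ in 𝓝 0, w (x + t • e) ≤ w x - t := by
    filter_upwards [(tendsto_line x e).eventually hle, Iio_mem_nhds hpos] with t ht htd
    refine ht.trans ?_
    have htd' : t < d := htd
    rw [he]
    refine (Metric.infDist_le_dist_of_mem hy).trans ?_
    rw [hye, dist_eq_norm, add_sub_add_left_eq_sub, ← sub_smul, norm_smul, he1, mul_one,
      Real.norm_of_nonpos (by linarith)]
    linarith
  have hLe : fderiv ℝ w x e ≤ -1 := by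
    have := le_fderiv_of_eventually (v := fun y => -w y) (x := x) (e := e) (c := 1) hd.neg (by
      filter_upwards [hray.filter_mono nhdsWithin_le_nhds] with t ht
      linarith)
    rw [fderiv_fun_neg] at this
    simpa using le_neg.1 (by simpa using this)
  have hg : gradient w x = -e := by
    rw [← norm_gradient] at hnorm
    have h1 : inner ℝ (gradient w x) e ≤ (-1 : ℝ) := by simpa using hLe
    have h2 : ‖gradient w x + e‖ ^ 2 ≤ 0 := by
      rw [norm_add_sq_real, he1]
      nlinarith [norm_nonneg (gradient w x)]
    have h3 : ‖gradient w x + e‖ = 0 := by nlinarith [norm_nonneg (gradient w x + e)]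
    exact eq_neg_of_add_eq_zero_left (norm_eq_zero.1 h3)
  rw [hg]
  refine ⟨by rw [norm_neg, he1], ?_⟩
  simp only [map_neg, neg_apply, neg_neg]
  have hdiff : ∀ᶠ t : ℝ in 𝓝 0, DifferentiableAt ℝ w (x + t • e) :=
    (tendsto_line x e).eventually ((hc.eventually (by simp)).mono fun y hy =>
      hy.differentiableAt (by simp))
  have hder : deriv (fun t : ℝ => w (x + t • e) + t) =ᶠ[𝓝 0]
      fun t => fderiv ℝ w (x + t • e) e + 1 := by
    filter_upwards [hdiff] with t ht
    exact ((hasDerivAt_line ht).add (hasDerivAt_id t)).deriv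
  have hd2 : HasDerivAt (fun t : ℝ => fderiv ℝ w (x + t • e) e + 1)
      (fderiv ℝ (fderiv ℝ w) x e e) 0 := by
    have h1 : DifferentiableAt ℝ (fderiv ℝ w) x :=
      (hc.fderiv_right (m := 1) (by norm_num)).differentiableAt (by simp)
    have h2 : HasDerivAt (fun t : ℝ => fderiv ℝ w (x + t • e)) (fderiv ℝ (fderiv ℝ w) x e) 0 := by
      have h3 : HasFDerivAt (fderiv ℝ w) (fderiv ℝ (fderiv ℝ w) x) (x + (0 : ℝ) • e) := by
        simpa using h1.hasFDerivAt
      exact h3.comp_hasDerivAt 0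
        ((((hasDerivAt_id (0 : ℝ)).smul_const e).const_add x).congr_deriv (by simp))
    exact (h2.clm_apply (hasDerivAt_const (0 : ℝ) e)).add_const (1 : ℝ) |>.congr_deriv (by simp)
  have hmax : IsLocalMax (fun t : ℝ => w (x + t • e) + t) 0 := by
    filter_upwards [hray] with t ht
    simp only [zero_smul, add_zero]
    linarith
  have hcont : ContinuousAt (fun t : ℝ => w (x + t • e) + t) 0 :=
    ((hasDerivAt_line (by simpa using hd)).add (hasDerivAt_id 0)).continuousAt
  have := deriv_deriv_nonpos_of_isLocalMax hcont hmax
  rwa [hder.deriv_eq, hd2.deriv] at this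

/-- A minimum is `≤ 0` once one entry is, so touching from above needs only the gradient bound;
touching from below needs both entries. -/
theorem isViscositySolution_infDist (hΩo : IsOpen Ω) (hne : Ωᶜ.Nonempty) :
    IsViscositySolution limitOperator Ω (Metric.infDist · Ωᶜ) := by
  have hc : Continuous (Metric.infDist · Ωᶜ) := Metric.continuous_infDist_pt _
  refine ⟨⟨hc.upperSemicontinuous.upperSemicontinuousOn _, fun x _ v hv => ?_⟩,
    ⟨hc.lowerSemicontinuous.lowerSemicontinuousOn _, fun x hx w hw => ?_⟩⟩
  · exact (min_le_left _ _).trans (sub_nonpos.2 (norm_gradient_le_one_of_touchesFromAbove hv))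
  · obtain ⟨h1, h2⟩ := touchesFromBelow_infDist hΩo hne hx hw
    exact le_min (sub_nonneg.2 h1.ge) (neg_nonneg.2 h2)

theorem isViscositySupersolution_infDist (hΩo : IsOpen Ω) (hne : Ωᶜ.Nonempty) :
    IsViscositySupersolution eikonalOperator Ω (Metric.infDist · Ωᶜ) :=
  ⟨(isViscositySolution_infDist hΩo hne).2.1, fun _ hx _ hw =>
    sub_nonneg.2 (touchesFromBelow_infDist hΩo hne hx hw).1.ge⟩

end Viscosity

/-! ### Approximation of the distance and convergence to it -/

section Distance

variable {n : ℕ} {Ω : Set (EuclideanSpace ℝ (Fin n))}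

open scoped Convolution

/-- The distance to the complement is approximated from below by `1`-Lipschitz test functions. -/
theorem exists_isTestFunction_infDist_le (hΩb : Bornology.IsBounded Ω) {δ : ℝ} (hδ : 0 < δ) :
    ∃ η : EuclideanSpace ℝ (Fin n) → ℝ, IsTestFunction Ω η ∧ (∀ x, ‖gradient η x‖ ≤ 1) ∧
      ∀ x, Metric.infDist x Ωᶜ - δ ≤ η x := by
  -- Truncating at height `2 * ε` and mollifying at scale `ε` keeps the support in `{ε ≤ d}`, a
  -- compact subset of `Ω`; the total loss is `3 * ε = δ`.
  set ε := δ / 3 with hε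
  have hε0 : 0 < ε := by positivity
  set d : EuclideanSpace ℝ (Fin n) → ℝ := fun x => Metric.infDist x Ωᶜ with hd
  have hdl : LipschitzWith 1 d := Metric.lipschitz_infDist_pt _
  set f : EuclideanSpace ℝ (Fin n) → ℝ := fun x => max (d x - 2 * ε) 0 with hf
  have hfl : ∀ x y, |f x - f y| ≤ ‖x - y‖ := by
    intro x y
    have h1 := hdl.dist_le_mul x y
    rw [Real.dist_eq, dist_eq_norm, NNReal.coe_one, one_mul] at h1
    refine (abs_max_sub_max_le_abs _ _ _).trans ?_
    simpa using h1
  have hfc : Continuous f := by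
    have := hdl.continuous
    fun_prop
  let ρ : ContDiffBump (0 : EuclideanSpace ℝ (Fin n)) := ⟨ε / 2, ε, by positivity, by linarith⟩
  set η : EuclideanSpace ℝ (Fin n) → ℝ :=
    ρ.normed volume ⋆[ContinuousLinearMap.lsmul ℝ ℝ, volume] f with hη
  have hclosed : IsClosed {x | ε ≤ d x} := isClosed_le continuous_const hdl.continuous
  have hsubΩ : {x | ε ≤ d x} ⊆ Ω := by
    intro x hx
    by_contra hxΩ
    have : d x = 0 := Metric.infDist_zero_of_mem hxΩ
    have hx' : ε ≤ d x := hx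
    linarith
  have hsupp : Function.support η ⊆ {x | ε ≤ d x} := by
    intro x hx
    obtain ⟨y, hy, t, ht, rfl⟩ := support_convolution_subset_swap _ hx
    rw [ρ.support_normed_eq, mem_ball_zero_iff] at ht
    have hy' : 2 * ε < d y := by
      by_contra! h
      exact hy (max_eq_right (by linarith))
    have h1 := infDist_le_add (Ω := Ω) y (y + t)
    have ht' : ‖t‖ < ε := ht
    rw [show y - (y + t) = -t by abel, norm_neg] at h1
    change ε ≤ Metric.infDist (y + t) Ωᶜ
    have : d y = Metric.infDist y Ωᶜ := rfl
    linarith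
  have hsmooth : ContDiff ℝ ∞ η :=
    ρ.hasCompactSupport_normed.contDiff_convolution_left _ ρ.contDiff_normed
      hfc.locallyIntegrable
  have hint : ∀ x, Integrable (fun t => ρ.normed volume t • f (x - t)) := by
    intro x
    refine Continuous.integrable_of_hasCompactSupport ?_ ?_
    · have := ρ.continuous_normed (μ := volume)
      fun_prop
    · exact ρ.hasCompactSupport_normed.smul_right
  have hlip : LipschitzWith 1 η := by
    refine LipschitzWith.of_dist_le_mul fun x y => ?_
    rw [NNReal.coe_one, one_mul, dist_eq_norm, dist_eq_norm]
    have : η x - η y = ∫ t, (ρ.normed volume t • f (x - t) - ρ.normed volume t • f (y - t)) :=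
      (integral_sub (hint x) (hint y)).symm
    rw [this]
    calc _ ≤ ∫ t, ρ.normed volume t * ‖x - y‖ := by
          refine norm_integral_le_of_norm_le (ρ.integrable_normed.mul_const _)
            (Eventually.of_forall fun t => ?_)
          rw [← smul_sub, norm_smul, Real.norm_of_nonneg (ρ.nonneg_normed t)]
          refine mul_le_mul_of_nonneg_left ?_ (ρ.nonneg_normed t)
          simpa using hfl (x - t) (y - t)
      _ = ‖x - y‖ := by rw [integral_mul_const, ρ.integral_normed, one_mul]
  refine ⟨η, ⟨hsmooth, ?_, ?_⟩, ?_, ?_⟩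
  · exact HasCompactSupport.of_support_subset_isCompact
      (Metric.isCompact_of_isClosed_isBounded hclosed (hΩb.subset hsubΩ)) hsupp
  · exact (closure_minimal hsupp hclosed).trans hsubΩ
  · intro x
    rw [norm_gradient]
    simpa using norm_fderiv_le_of_lipschitz ℝ hlip (x₀ := x)
  · intro x
    have h1 : dist (η x) (f x) ≤ ε := by
      refine ρ.dist_normed_convolution_le hfc.aestronglyMeasurable fun y hy => ?_
      rw [Real.dist_eq]
      exact (hfl y x).trans (mem_ball_iff_norm.1 hy).le
    rw [Real.dist_eq, abs_le] at h1
    have h2 : d x - 2 * ε ≤ f x := le_max_left _ _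
    change d x - δ ≤ η x
    linarith [h1.1]

/-- Asymptotically `1`-Lipschitz functions that vanish outside `Ω` and have asymptotically at least
the integral of the distance function converge to the distance function. -/
theorem tendstoUniformly_infDist (hΩo : IsOpen Ω) (hΩb : Bornology.IsBounded Ω)
    (hn : 1 ≤ n) {v : ℕ → EuclideanSpace ℝ (Fin n) → ℝ}
    (hc : ∀ k, Continuous (v k)) (h0 : ∀ k, ∀ x ∉ Ω, v k x = 0)
    (hlip : ∀ ε : ℝ, 0 < ε → ∀ᶠ k in atTop, ∀ x y, |v k x - v k y| ≤ ε + (1 + ε) * ‖x - y‖)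
    (hint : ∀ ε : ℝ, 0 < ε → ∀ᶠ k in atTop,
      (∫ x in Ω, Metric.infDist x Ωᶜ) - ε ≤ ∫ x in Ω, v k x) :
    TendstoUniformly v (Metric.infDist · Ωᶜ) atTop := by
  obtain ⟨D, hD0, hD⟩ := exists_notMem_norm_sub_le hn hΩb
  have hdc : Continuous fun x => Metric.infDist x Ωᶜ := Metric.continuous_infDist_pt _
  have hdz : ∀ x ∉ Ω, Metric.infDist x Ωᶜ = 0 := fun x hx => Metric.infDist_zero_of_mem hx
  have hdD : ∀ x, Metric.infDist x Ωᶜ ≤ D := by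
    intro x
    by_cases hx : x ∈ Ω
    · obtain ⟨y, hy, hxy⟩ := hD x hx
      exact (Metric.infDist_le_dist_of_mem (Set.mem_compl hy)).trans (by rwa [dist_eq_norm])
    · rw [hdz x hx]; exact hD0
  have hfin : IsFiniteMeasure (volume.restrict Ω) := ⟨by simpa using hΩb.measure_lt_top⟩
  have hcpt := hΩb.isCompact_closure
  have hion : ∀ f : EuclideanSpace ℝ (Fin n) → ℝ, Continuous f → IntegrableOn f Ω := fun f hf =>
    (hf.continuousOn.integrableOn_compact hcpt).mono_set subset_closure
  rw [Metric.tendstoUniformly_iff]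
  intro δ hδ
  set r := δ / 8 with hr
  have hr0 : 0 < r := by positivity
  set m := volume.real (Metric.ball (0 : EuclideanSpace ℝ (Fin n)) r) with hm
  have hm0 : 0 < m :=
    ENNReal.toReal_pos (Metric.measure_ball_pos _ _ hr0).ne' measure_ball_lt_top.ne
  set V := volume.real Ω with hV
  have hV0 : 0 ≤ V := measureReal_nonneg
  -- The bounds `ε ≤ 1` and `ε ≤ δ / 8` propagate a gap `δ` at `x` to a gap `δ - 3 * r - ε ≥ δ / 2`
  -- on the ball of radius `r`; the fourth condition gives the upper estimate, the last one the
  -- final contradiction of integrals.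
  obtain ⟨ε, hε0, hε1, hε2, hε3, hε4⟩ : ∃ ε : ℝ, 0 < ε ∧ ε ≤ 1 ∧ ε ≤ δ / 8 ∧
      ε * (1 + D) < δ ∧ ε * ((1 + D) * V + 1) < δ / 2 * m := by
    have t : ∀ c : ℝ, Tendsto (fun ε : ℝ => ε * c) (𝓝[>] 0) (𝓝 0) := fun c => by
      have : Continuous fun ε : ℝ => ε * c := by fun_prop
      simpa using (this.tendsto 0).mono_left nhdsWithin_le_nhds
    have t1 := t 1
    simp only [mul_one] at t1
    obtain ⟨ε, h⟩ := ((eventually_mem_nhdsWithin (a := (0 : ℝ)) (s := Set.Ioi 0)).and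
      ((t1.eventually_le_const one_pos).and ((t1.eventually_le_const (by positivity : 0 < δ / 8)).and
      (((t (1 + D)).eventually_lt_const hδ).and
      ((t ((1 + D) * V + 1)).eventually_lt_const (by positivity : 0 < δ / 2 * m)))))).exists
    exact ⟨ε, h⟩
  filter_upwards [hlip ε hε0, hint ε hε0] with k hk1 hk2 x
  have hup : ∀ x, v k x ≤ Metric.infDist x Ωᶜ + ε * (1 + D) := by
    intro x
    have hne : Ωᶜ.Nonempty := by
      by_cases hx : x ∈ Ω
      · obtain ⟨y, hy, -⟩ := hD x hx
        exact ⟨y, hy⟩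
      · exact ⟨x, hx⟩
    obtain ⟨y, hy, hxy⟩ := hΩo.isClosed_compl.exists_infDist_eq_dist hne x
    have h1 := (le_abs_self _).trans (hk1 x y)
    rw [h0 k y hy, ← dist_eq_norm, ← hxy] at h1
    nlinarith [hdD x]
  rw [Real.dist_eq, abs_lt]
  refine ⟨by linarith [hup x], ?_⟩
  by_contra! hcon
  have hball : ∀ y ∈ Metric.ball x r, δ / 2 ≤ Metric.infDist y Ωᶜ - v k y := by
    intro y hy
    have hxy : ‖y - x‖ ≤ r := (mem_ball_iff_norm.1 hy).le
    have h1 := (le_abs_self _).trans (hk1 y x)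
    have h2 := infDist_le_add (Ω := Ω) x y
    rw [norm_sub_rev] at h2
    have h3 : (1 + ε) * ‖y - x‖ ≤ 2 * r := by
      have := norm_nonneg (y - x)
      nlinarith
    linarith
  have hsub : Metric.ball x r ⊆ Ω := by
    intro y hy
    by_contra hyΩ
    have := hball y hy
    rw [hdz y hyΩ, h0 k y hyΩ] at this
    linarith
  -- By `hup`, adding `ε * (1 + D)` makes the gap nonnegative on all of `Ω`, so its integral
  -- dominates the one over the ball.
  have hI : IntegrableOn (fun y => Metric.infDist y Ωᶜ - v k y + ε * (1 + D)) Ω :=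
    hion _ ((hdc.sub (hc k)).add continuous_const)
  have hlow : δ / 2 * m ≤ ∫ y in Ω, (Metric.infDist y Ωᶜ - v k y + ε * (1 + D)) := by
    calc δ / 2 * m = δ / 2 * volume.real (Metric.ball x r) := by
          rw [hm, Measure.addHaar_real_ball_center volume x]
      _ ≤ ∫ y in Metric.ball x r, (Metric.infDist y Ωᶜ - v k y + ε * (1 + D)) := by
          refine setIntegral_ge_of_const_le_real measurableSet_ball measure_ball_lt_top.ne
            (fun y hy => ?_) (hI.mono_set hsub)
          have := hball y hy
          have : 0 ≤ ε * (1 + D) := by positivity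
          linarith
      _ ≤ _ := by
          refine setIntegral_mono_set hI (Eventually.of_forall fun y => ?_)
            (LE.le.eventuallyLE hsub)
          have := hup y
          change 0 ≤ Metric.infDist y Ωᶜ - v k y + ε * (1 + D)
          linarith
  have hsplit : ∫ y in Ω, (Metric.infDist y Ωᶜ - v k y + ε * (1 + D)) =
      (∫ y in Ω, Metric.infDist y Ωᶜ) - (∫ y in Ω, v k y) + ∫ _ in Ω, ε * (1 + D) := by
    rw [← integral_sub (hion _ hdc) (hion _ (hc k))]
    exact integral_add ((hion _ hdc).sub (hion _ (hc k))) (integrable_const _)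
  rw [hsplit] at hlow
  have hconst : ∫ _ in Ω, ε * (1 + D) = ε * (1 + D) * V := by
    simp [hV, mul_comm]
  rw [hconst] at hlow
  nlinarith

end Distance

/-! ### Uniform estimates and the limit `p → ∞` -/

section Limit

variable {n : ℕ} {Ω : Set (EuclideanSpace ℝ (Fin n))}

/-- The continuous representative of a weak solution, with all estimates that survive the limit
`p → ∞`; `M` is the `L^p` norm of its gradient. -/
theorem IsWeakSolution.exists_representative (hn : 1 ≤ n) (hΩb : Bornology.IsBounded Ω) {p : ℝ}
    (hp : 1 < p) (hpn : 2 * n ≤ p) {u : EuclideanSpace ℝ (Fin n) → ℝ} (h : IsWeakSolution p Ω u)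
    {D : ℝ} (hD0 : 0 ≤ D) (hD : ∀ x ∈ Ω, ∃ y ∉ Ω, ‖x - y‖ ≤ D) :
    ∃ (v : EuclideanSpace ℝ (Fin n) → ℝ) (M : ℝ), 0 ≤ M ∧ Continuous v ∧ (∀ x ∉ Ω, v x = 0) ∧
      v =ᵐ[volume.restrict Ω] u ∧
      M ^ p ≤ morreyFactor n p 1 * ((4 + D) * volume.real Ω) * M ∧
      (∀ r : ℝ, 0 < r → ∀ x y, |v x - v y| ≤ morreyFactor n p r * (4 * r + ‖x - y‖) * M) ∧
      ∀ η : EuclideanSpace ℝ (Fin n) → ℝ, IsTestFunction Ω η → (∀ x, ‖gradient η x‖ ≤ 1) →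
        ∫ x in Ω, η x ≤ (∫ x in Ω, v x) + volume.real Ω / p := by
  obtain ⟨G, hG, hw⟩ := h
  obtain ⟨v, hvc, hv0, hvu, hmod⟩ := hG.exists_continuous_representative hn hΩb hp.le hpn
  have hint : ∫ x in Ω, v x = ∫ x in Ω, u x := integral_congr_ae hvu
  refine ⟨v, _, ENNReal.toReal_nonneg, hvc, hv0, hvu, ?_, hmod, fun η hη hη1 => ?_⟩
  -- `M ^ p = ∫ |G|^p = ∫ v`, which is at most `|Ω|` times the sup bound from the modulus with `r =
  -- 1`; that bound is linear in `M`.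
  · have hM := toReal_eLpNorm_eq (by linarith) hG.1.2.1
    set M := (eLpNorm G (ENNReal.ofReal p) (volume.restrict Ω)).toReal with hMdef
    have hI0 : 0 ≤ ∫ x in Ω, ‖G x‖ ^ p :=
      integral_nonneg fun _ => Real.rpow_nonneg (norm_nonneg _) _
    have hMp : M ^ p = ∫ x in Ω, v x := by
      rw [hM, ← Real.rpow_mul hI0, one_div_mul_cancel (by linarith), Real.rpow_one, hint,
        integral_rpow_eq_of_weak hΩb hp hG hw]
    rw [hMp]
    refine (Real.le_norm_self _).trans ((norm_setIntegral_le_of_norm_le_const hΩb.measure_lt_top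
      fun x _ => abs_le_of_modulus hv0 (morreyFactor_nonneg n p one_pos) ENNReal.toReal_nonneg
        hD0 hD (hmod 1 one_pos) x).trans (le_of_eq ?_))
    ring
  · rw [hint]
    exact integral_test_le_of_weak hΩb hp hG hw hη hη1

lemma tendsto_morreyFactor (n : ℕ) {r : ℝ} (hr : 0 < r) {q : ℕ → ℝ} (hq : Tendsto q atTop atTop) :
    Tendsto (fun k => morreyFactor n (q k) r) atTop (𝓝 1) := by
  have hV : 0 < volume.real (Metric.ball (0 : EuclideanSpace ℝ (Fin n)) 1) :=
    ENNReal.toReal_pos (Metric.measure_ball_pos _ _ one_pos).ne' measure_ball_lt_top.ne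
  have h1 : Tendsto (fun k => -(1 / q k)) atTop (𝓝 0) := by
    simpa using (tendsto_inv_atTop_zero.comp hq).neg
  simpa [morreyFactor] using tendsto_const_nhds.rpow h1 (Or.inl (by positivity :
    r ^ n * volume.real (Metric.ball (0 : EuclideanSpace ℝ (Fin n)) 1) ≠ 0))

/-- Dividing by `M` leaves the power `p - 1`. Only a bound on `C` uniform in `p` is needed for the
right-hand side to have limit at most `1`. -/
lemma le_rpow_of_rpow_le_mul {M C p : ℝ} (hp : 1 < p) (hM : 0 ≤ M) (hC : 0 ≤ C)
    (h : M ^ p ≤ C * M) : M ≤ C ^ (1 / (p - 1)) := by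
  have hp1 : 0 < p - 1 := by linarith
  rcases hM.eq_or_lt with h0 | h0
  · rw [← h0]; positivity
  · have h1 : M ^ (p - 1) ≤ C := by
      rw [Real.rpow_sub_one h0.ne', div_le_iff₀ h0]
      exact h
    calc M = (M ^ (p - 1)) ^ (1 / (p - 1)) := by
          rw [← Real.rpow_mul hM, mul_one_div_cancel hp1.ne', Real.rpow_one]
      _ ≤ _ := Real.rpow_le_rpow (by positivity) h1 (by positivity)

/-- The solutions of `-Δ_p u = 1` converge uniformly to the distance to the boundary. -/
theorem exists_tendstoUniformly_infDist (hn : 1 ≤ n) (hΩo : IsOpen Ω)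
    (hΩb : Bornology.IsBounded Ω) {q : ℕ → ℝ} (hq1 : ∀ k, 1 < q k) (hqn : ∀ k, 2 * n ≤ q k)
    (hq : Tendsto q atTop atTop) {u : ℕ → EuclideanSpace ℝ (Fin n) → ℝ}
    (hu : ∀ k, IsWeakSolution (q k) Ω (u k)) :
    ∃ v : ℕ → EuclideanSpace ℝ (Fin n) → ℝ,
      (∀ k, v k =ᵐ[volume.restrict Ω] u k ∧ Continuous (v k) ∧ ∀ x ∉ Ω, v k x = 0) ∧
      TendstoUniformly v (Metric.infDist · Ωᶜ) atTop := by
  obtain ⟨D, hD0, hD⟩ := exists_notMem_norm_sub_le hn hΩb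
  choose v M hM0 hvc hv0 hvu hMp hmod htest using fun k =>
    (hu k).exists_representative hn hΩb (hq1 k) (hqn k) hD0 hD
  refine ⟨v, fun k => ⟨hvu k, hvc k, hv0 k⟩, tendstoUniformly_infDist hΩo hΩb hn hvc hv0 ?_ ?_⟩
  -- The `2` bounds the Morrey factor for large `k`; the `+ 1` keeps `C` positive even when `Ω` is
  -- empty.
  · set C : ℝ := 2 * ((4 + D) * volume.real Ω) + 1 with hC
    have hV0 : 0 ≤ volume.real Ω := measureReal_nonneg
    have hC0 : 0 < C := by positivity
    have hM : ∀ᶠ k in atTop, M k ≤ C ^ (1 / (q k - 1)) := by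
      filter_upwards [(tendsto_morreyFactor n one_pos hq).eventually_le_const one_lt_two] with k hk
      refine le_rpow_of_rpow_le_mul (hq1 k) (hM0 k) hC0.le ((hMp k).trans ?_)
      refine mul_le_mul_of_nonneg_right ?_ (hM0 k)
      have : 0 ≤ (4 + D) * volume.real Ω := by positivity
      nlinarith
    have hlim : Tendsto (fun k => C ^ (1 / (q k - 1))) atTop (𝓝 1) := by
      have h1 : Tendsto (fun k => 1 / (q k - 1)) atTop (𝓝 0) := by
        simpa [Function.comp_def, sub_eq_add_neg] using
          tendsto_inv_atTop_zero.comp (tendsto_atTop_add_const_right atTop (-1) hq)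
      simpa using tendsto_const_nhds.rpow h1 (Or.inl hC0.ne')
    intro ε hε
    -- With `r = ε / 8` the additive term is `4 * r = ε / 2`, and its coefficient is eventually at
    -- most `2`.
    have hr : 0 < ε / 8 := by positivity
    have h2 : Tendsto (fun k => morreyFactor n (q k) (ε / 8) * C ^ (1 / (q k - 1))) atTop
        (𝓝 1) := by simpa using (tendsto_morreyFactor n hr hq).mul hlim
    filter_upwards [hM, h2.eventually_le_const (lt_add_of_pos_right 1 hε),
      h2.eventually_le_const one_lt_two] with k hk1 hk2 hk3 x y
    have hs : morreyFactor n (q k) (ε / 8) * M k ≤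
        morreyFactor n (q k) (ε / 8) * C ^ (1 / (q k - 1)) :=
      mul_le_mul_of_nonneg_left hk1 (morreyFactor_nonneg n _ hr)
    calc |v k x - v k y| ≤ morreyFactor n (q k) (ε / 8) * (4 * (ε / 8) + ‖x - y‖) * M k :=
          hmod k _ hr x y
      _ = (morreyFactor n (q k) (ε / 8) * M k) * (ε / 2) +
          (morreyFactor n (q k) (ε / 8) * M k) * ‖x - y‖ := by ring
      _ ≤ 2 * (ε / 2) + (1 + ε) * ‖x - y‖ := by
          gcongr
          · exact hs.trans hk3
          · exact hs.trans hk2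
      _ = _ := by ring
  · intro ε hε
    have hV0 : 0 ≤ volume.real Ω := measureReal_nonneg
    set V := volume.real Ω with hV
    have hfin : IsFiniteMeasure (volume.restrict Ω) := ⟨by simpa using hΩb.measure_lt_top⟩
    -- Half of `ε` pays for replacing the distance by `η`, the other half for the Young error `V / q
    -- k`.
    set δ := ε / (2 * (V + 1)) with hδ
    have hδ0 : 0 < δ := by positivity
    have hδV : δ * V ≤ ε / 2 := by
      rw [hδ, div_mul_eq_mul_div, div_le_iff₀ (by positivity)]
      nlinarith
    obtain ⟨η, hη, hη1, hηd⟩ := exists_isTestFunction_infDist_le hΩb hδ0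
    have hdi : IntegrableOn (fun x => Metric.infDist x Ωᶜ) Ω :=
      ((Metric.continuous_infDist_pt _).continuousOn.integrableOn_compact
        hΩb.isCompact_closure).mono_set subset_closure
    have hle : (∫ x in Ω, Metric.infDist x Ωᶜ) - δ * V ≤ ∫ x in Ω, η x := by
      calc (∫ x in Ω, Metric.infDist x Ωᶜ) - δ * V = ∫ x in Ω, (Metric.infDist x Ωᶜ - δ) := by
            rw [integral_sub hdi (integrable_const _)]
            simp [hV, mul_comm]
        _ ≤ _ := integral_mono (hdi.sub (integrable_const _))
            (memLp_one_iff_integrable.1 (hη.memLp 1 _)) hηd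
    have hlim : Tendsto (fun k => V / q k) atTop (𝓝 0) := hq.const_div_atTop V
    filter_upwards [hlim.eventually_le_const (half_pos hε)] with k hk
    linarith [htest k η hη hη1]

end Limit

end PTorsion

theorem mainTheorem6 (n : ℕ) (hn : 1 ≤ n)
    (Ω : Set (EuclideanSpace ℝ (Fin n))) (hΩo : IsOpen Ω) (hΩb : Bornology.IsBounded Ω)
    (p : ℕ → ℝ) (hp : ∀ k, 1 < p k) (hp_top : Tendsto p atTop atTop)
    (u : ℕ → EuclideanSpace ℝ (Fin n) → ℝ)
    (hu : ∀ k, PTorsion.IsWeakSolution (p k) Ω (u k)) :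
    ∃ (σ : ℕ → ℕ) (v : ℕ → EuclideanSpace ℝ (Fin n) → ℝ)
      (uinf : EuclideanSpace ℝ (Fin n) → ℝ),
      StrictMono σ ∧
      (∀ k, v k =ᵐ[volume.restrict Ω] u (σ k) ∧ ContinuousOn (v k) (closure Ω) ∧
        ∀ x ∈ frontier Ω, v k x = 0) ∧
      TendstoUniformlyOn v uinf atTop (closure Ω) ∧
      (∃ C α : ℝ≥0, 0 < α ∧ α ≤ 1 ∧ HolderOnWith C α uinf (closure Ω)) ∧
      PTorsion.IsViscositySolution PTorsion.limitOperator Ω uinf ∧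
      (∀ x ∈ frontier Ω, uinf x = 0) ∧
      PTorsion.IsViscositySupersolution PTorsion.eikonalOperator Ω uinf := by
  -- The subsequence is merely a tail: dropping finitely many terms ensures `2 * n ≤ p k`, as
  -- Morrey's estimate requires.
  obtain ⟨K, hK⟩ := eventually_atTop.1 (hp_top.eventually_ge_atTop (2 * n : ℝ))
  have hfr : ∀ x ∈ frontier Ω, x ∉ Ω := fun x hx => by
    rw [hΩo.frontier_eq] at hx
    exact hx.2
  have hne : Ωᶜ.Nonempty := by
    have : Nonempty (Fin n) := ⟨⟨0, hn⟩⟩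
    by_contra h
    rw [Set.not_nonempty_iff_eq_empty, Set.compl_empty_iff] at h
    exact NormedSpace.unbounded_univ ℝ (EuclideanSpace ℝ (Fin n)) (h ▸ hΩb)
  obtain ⟨v, hv, hlim⟩ := PTorsion.exists_tendstoUniformly_infDist hn hΩo hΩb
    (q := fun k => p (k + K)) (fun k => hp _) (fun k => hK _ (Nat.le_add_left _ _))
    (hp_top.comp (tendsto_add_atTop_nat K)) (fun k => hu (k + K))
  refine ⟨fun k => k + K, v, (Metric.infDist · Ωᶜ), fun a b hab => Nat.add_lt_add_right hab K,
    fun k => ⟨(hv k).1, (hv k).2.1.continuousOn, fun x hx => (hv k).2.2 x (hfr x hx)⟩,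
    hlim.tendstoUniformlyOn, ⟨1, 1, one_pos, le_rfl, ?_⟩,
    PTorsion.isViscositySolution_infDist hΩo hne,
    fun x hx => Metric.infDist_zero_of_mem (hfr x hx),
    PTorsion.isViscositySupersolution_infDist hΩo hne⟩
  exact holderOnWith_one.2 (Metric.lipschitz_infDist_pt _).lipschitzOnWith
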